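/- **Theorem 4.3.** Let $p>3$ be a prime. For rational numbers $x,y$ whose denominators (in lowest terms) are not divisible by $p$, write $x\equiv y \pmod{p^2}$ if $x-y=p^2z$ for some rational $z$ whose denominator is not divisible by $p$, and let $\left(\frac{p}{3}\right)$ denote the Legendre symbol. Then both sides of each of the following congruences have denominators not divisible by $p$, and $$\sum_{k=0}^{(p-1)/2}\frac{\binom{2k}{k}\binom{4k}{2k}}{(2k-1)64^k}\equiv(-1)^{\frac{p+1}{2}}\,\frac{p+1}{2}\pmod{p^2},\tag{i}$$ $$\sum_{k=0}^{(p-1)/2}\frac{\binom{2k}{k}\binom{3k}{k}}{(2k-1)27^k}\equiv\frac19\left(\frac{p}{3}\right)\left(2^{p+1}-7-6p\right)\pmod{p^2},\tag{ii}$$ $$\sum_{k=0}^{(p-1)/2}\frac{\binom{3k}{k}\binom{6k}{3k}}{(2k-1)432^k}\equiv-\frac19\left(\frac{p}{3}\right)\left(2^{p+1}+2+3p\right)\pmod{p^2}.\tag{iii}$$ -/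

import Mathlib

/-- `x` is a rational `p`-integer: its denominator in lowest terms is not divisible by `p`. -/
def IsRatPIntegral (p : ℕ) (x : ℚ) : Prop := ¬ p ∣ x.den

/-- `x ≡ y (mod p ^ n)` in the ring of rational `p`-integers: both sides are `p`-integral and
their difference is `p ^ n` times a rational `p`-integer. -/
def RatModEqPow (p n : ℕ) (x y : ℚ) : Prop :=
  IsRatPIntegral p x ∧ IsRatPIntegral p y ∧
    ∃ z : ℚ, IsRatPIntegral p z ∧ x - y = (p : ℚ) ^ n * z

/-! Put F(a) = ∑_{k≤n} (-a)_k (a+1)_k / (k!² (2k-1)) with n = (p-1)/2; this is `prodSum` with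
p-integral coefficients. The three sums are F(-1/4), F(-1/3), F(-1/6).

A contiguous relation (`prodSum_eval_succ`) gives F(m) = -(2m+1) for integers 0 ≤ m ≤ n, and F(-1-a)
= F(a). So F mod p, of degree at most 2n = p-1, is known at every residue, and interpolation yields
F'(m) ≡ -2(2m+1)(H_m - H_{n-m}) mod p (`derivative_eval_eq_harmonic`).

For d = 4, 3, 6 either -1/d or its mirror -1+1/d equals m + pt with 0 ≤ m ≤ n and t = -1/d, so F(m)
+ pt F'(m) is the sum mod p² (`prodSum_padic_congr`). For d = 4 the harmonic difference is 0 or a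
single term; for d = 3, 6 it reduces to H_{⌊p/3⌋} - H_{⌊p/6⌋} ≡ (2^p-2)/p, obtained by trisecting
(1+1)^p (`fermat_quotient_two`). -/

section

open Polynomial

/-! ### The hypergeometric polynomial and its values at integers -/

/-- The polynomial `∑ k ≤ n, c k * ∏ i < k, (i (i + 1) - X (X + 1))`. -/
noncomputable def prodSum {R : Type*} [CommRing R] (c : ℕ → R) (n : ℕ) : R[X] :=
  ∑ k ∈ Finset.range (n + 1),
    C (c k) * ∏ i ∈ Finset.range k, (C ((i : R) * (i + 1)) - X * (X + 1))

theorem prodSum_eval {R : Type*} [CommRing R] (c : ℕ → R) (n : ℕ) (a : R) :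
    (prodSum c n).eval a =
      ∑ k ∈ Finset.range (n + 1),
        c k * ∏ i ∈ Finset.range k, ((i : R) * (i + 1) - a * (a + 1)) := by
  simp [prodSum, eval_finsetSum, eval_prod]

theorem prodSum_eval_neg {R : Type*} [CommRing R] (c : ℕ → R) (n : ℕ) (a : R) :
    (prodSum c n).eval (-1 - a) = (prodSum c n).eval a := by
  simp only [prodSum_eval]
  congr! 4
  ring

theorem prodSum_natDegree_le {R : Type*} [CommRing R] (c : ℕ → R) (n : ℕ) :
    (prodSum c n).natDegree ≤ 2 * n := by
  refine natDegree_sum_le_of_forall_le _ _ fun k hk => ?_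
  have hk : k ≤ n := by simpa [Nat.lt_succ_iff] using hk
  refine (natDegree_C_mul_le _ _).trans ((natDegree_prod_le _ _).trans ?_)
  refine (Finset.sum_le_card_nsmul _ _ 2 fun i _ => ?_).trans ?_
  · compute_degree
  · simp; omega

theorem prodSum_map {R S : Type*} [CommRing R] [CommRing S] (f : R →+* S) (c : ℕ → R) (n : ℕ) :
    (prodSum c n).map f = prodSum (fun k => f (c k)) n := by
  simp [prodSum, Polynomial.map_sum, Polynomial.map_prod]

/-- The partial sums of `₂F₁(b, -b; 1; 1)` in closed form. -/
theorem sum_prod_sq_sub_sq {R : Type*} [CommRing R] [IsDomain R] [CharZero R] (w : ℕ → R) (n : ℕ)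
    (hw : ∀ k ≤ n, w k * (k.factorial : R) ^ 2 = 1) (b : R) :
    ∑ k ∈ Finset.range (n + 1), w k * ∏ i ∈ Finset.range k, ((i : R) ^ 2 - b ^ 2) =
      w n * ∏ i ∈ Finset.range n, (((i : R) + 1) ^ 2 - b ^ 2) := by
  induction n with
  | zero => simp
  | succ n ih =>
    rw [Finset.sum_range_succ, ih fun k hk => hw k (by omega), Finset.prod_range_succ',
      Finset.prod_range_succ]
    have h1 := hw n (by omega)
    have h2 := hw (n + 1) le_rfl
    have hn : ((n.factorial : R)) ^ 2 ≠ 0 :=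
      pow_ne_zero _ (Nat.cast_ne_zero.2 n.factorial_ne_zero)
    have h3 : w n = w (n + 1) * ((n : R) + 1) ^ 2 := by
      apply mul_right_cancel₀ hn
      rw [Nat.factorial_succ] at h2
      push_cast at h2
      linear_combination h1 - h2
    rw [h3]
    push_cast
    ring

/-- With b = a+1, both (-a)_k (a+1)_k and (-b)_k (b+1)_k are linear multiples of (-b)_k (b)_k;
stated without division by b. -/
theorem prod_contiguous {R : Type*} [CommRing R] (a : R) (k : ℕ) :
    (a + 1) * ∏ i ∈ Finset.range k, ((i : R) * (i + 1) - a * (a + 1)) =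
        (a + 1 - k) * ∏ i ∈ Finset.range k, ((i : R) ^ 2 - (a + 1) ^ 2) ∧
      (a + 1) * ∏ i ∈ Finset.range k, ((i : R) * (i + 1) - (a + 1) * (a + 1 + 1)) =
        (a + 1 + k) * ∏ i ∈ Finset.range k, ((i : R) ^ 2 - (a + 1) ^ 2) := by
  induction k with
  | zero => simp
  | succ k ih =>
    simp only [Finset.prod_range_succ, ← mul_assoc, ih.1, ih.2]
    push_cast
    constructor <;> ring

/-- The multipliers 2a+1 and 2a+3 are chosen so that (2a+1)(b+k) - (2a+3)(b-k) = 2b(2k-1), where b =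
a+1: the denominator 2k-1 cancels and a summable ₂F₁(b,-b;1;1) remains. -/
theorem prodSum_eval_succ {R : Type*} [CommRing R] [IsDomain R] [CharZero R] (c : ℕ → R) (n : ℕ)
    (hc : ∀ k ≤ n, c k * ((k.factorial : R) ^ 2 * (2 * k - 1)) = 1) (a : R) (ha : a + 1 ≠ 0) :
    (2 * a + 1) * (prodSum c n).eval (a + 1) - (2 * a + 3) * (prodSum c n).eval a =
      2 * (c n * (2 * n - 1) * ∏ i ∈ Finset.range n, (((i : R) + 1) ^ 2 - (a + 1) ^ 2)) := by
  rw [← sum_prod_sq_sub_sq (fun k => c k * (2 * k - 1)) n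
    (fun k hk => by linear_combination hc k hk) (a + 1), prodSum_eval, prodSum_eval]
  simp only [Finset.mul_sum]
  rw [← Finset.sum_sub_distrib]
  refine Finset.sum_congr rfl fun k _ => ?_
  obtain ⟨h1, h2⟩ := prod_contiguous a k
  apply mul_left_cancel₀ ha
  linear_combination c k * (2 * a + 1) * h2 - c k * (2 * a + 3) * h1

theorem prodSum_eval_natCast {R : Type*} [CommRing R] [IsDomain R] [CharZero R] (c : ℕ → R) (n : ℕ)
    (hc : ∀ k ≤ n, c k * ((k.factorial : R) ^ 2 * (2 * k - 1)) = 1) (m : ℕ) (hm : m ≤ n) :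
    (prodSum c n).eval (m : R) = -(2 * m + 1) := by
  induction m with
  | zero =>
    rw [prodSum_eval, Finset.sum_eq_single 0]
    · have := hc 0 (by omega)
      simp at this ⊢
      linear_combination -this
    · intro k _ hk
      rw [Finset.prod_eq_zero (i := 0) (by simp; omega) (by simp), mul_zero]
    · simp
  | succ m ih =>
    have ih := ih (by omega)
    have h := prodSum_eval_succ c n hc (m : R) (Nat.cast_add_one_ne_zero m)
    -- The closed form has the factor (m+1)² - (m+1)², since m < n.
    rw [Finset.prod_eq_zero (i := m) (by simp; omega) (by simp), ih] at h
    have h0 : (2 * (m : R) + 1) ≠ 0 := by exact_mod_cast (by omega : 2 * m + 1 ≠ 0)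
    push_cast
    apply mul_left_cancel₀ h0
    linear_combination h

/-! ### Interpolation and harmonic sums modulo p -/

/-- The derivative of a polynomial of degree less than `p` over `ZMod p` by interpolation. -/
theorem derivative_eval_eq_sum_zmod (p : ℕ) [Fact p.Prime] (hp : 2 < p) (P : (ZMod p)[X])
    (hP : P.natDegree < p) (x : ZMod p) :
    P.derivative.eval x = ∑ j : ZMod p, P.eval j * (x - j)⁻¹ := by
  -- Valid at y = 0 too, because 0⁻¹ = 0 and p > 2; hence the node j = x needs no separate
  -- treatment.
  have hpow : ∀ y : ZMod p, y ^ (p - 2) = y⁻¹ := fun y => by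
    by_cases hy : y = 0
    · rw [hy, inv_zero, zero_pow (by omega)]
    · refine eq_inv_of_mul_eq_one_left ?_
      rw [← pow_succ, show p - 2 + 1 = p - 1 by omega,
        ZMod.pow_card_sub_one_eq_one hy]
  -- By Fermat, 1 - (X - j)^(p-1) is the indicator of j on `ZMod p`.
  have key : P = ∑ j : ZMod p, C (P.eval j) * (1 - (X - C j) ^ (p - 1)) := by
    apply Polynomial.eq_of_degrees_lt_of_eval_finset_eq Finset.univ
    · rw [Finset.card_univ, ZMod.card]
      exact degree_le_natDegree.trans_lt (by exact_mod_cast hP)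
    · rw [Finset.card_univ, ZMod.card]
      refine degree_le_natDegree.trans_lt (Nat.cast_lt.2 (Nat.lt_of_le_of_lt
        (natDegree_sum_le_of_forall_le _ _ (n := p - 1) fun j _ => ?_) (by omega)))
      refine (natDegree_C_mul_le _ _).trans ?_
      compute_degree
    · intro y _
      rw [eval_finsetSum, Finset.sum_eq_single y]
      · simp [zero_pow (by omega : p - 1 ≠ 0)]
      · intro j _ hj
        simp [ZMod.pow_card_sub_one_eq_one (sub_ne_zero.2 hj.symm)]
      · simp
  conv_lhs => rw [key]
  rw [derivative_sum, eval_finsetSum]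
  refine Finset.sum_congr rfl fun j _ => ?_
  have : ((p - 1 : ℕ) : ZMod p) = -1 := by
    rw [Nat.cast_sub (by omega)]; simp
  simp [derivative_X_sub_C_pow, this, show p - 1 - 1 = p - 2 by omega, hpow]

theorem sum_zmod_eq_sum_range (p : ℕ) [NeZero p] {M : Type*} [AddCommMonoid M] (f : ZMod p → M) :
    ∑ j : ZMod p, f j = ∑ j ∈ Finset.range p, f (j : ZMod p) := by
  symm
  refine Finset.sum_bij (fun j _ => (j : ZMod p)) (by simp) ?_ ?_ (by simp)
  · intro a ha b hb h
    rw [Finset.mem_range] at ha hb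
    have := congrArg ZMod.val h
    rwa [ZMod.val_cast_of_lt ha, ZMod.val_cast_of_lt hb] at this
  · intro b _
    exact ⟨b.val, Finset.mem_range.2 b.val_lt, by simp⟩

/-- Harmonic numbers in a field. -/
def fieldHarmonic (K : Type*) [Field K] (n : ℕ) : K := ∑ i ∈ Finset.range n, ((i : K) + 1)⁻¹

theorem fieldHarmonic_succ (K : Type*) [Field K] (n : ℕ) :
    fieldHarmonic K (n + 1) = fieldHarmonic K n + ((n : K) + 1)⁻¹ :=
  Finset.sum_range_succ _ _

theorem sum_inv_sub (K : Type*) [Field K] (m r : ℕ) :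
    ∑ j ∈ Finset.range (m + r + 1), ((m : K) - j)⁻¹ = fieldHarmonic K m - fieldHarmonic K r := by
  induction r with
  | zero =>
    rw [add_zero, Finset.sum_range_succ, ← Finset.sum_range_reflect]
    simp only [fieldHarmonic, Finset.sum_range_zero, sub_self, inv_zero, add_zero, sub_zero]
    refine Finset.sum_congr rfl fun j hj => ?_
    rw [Finset.mem_range] at hj
    rw [Nat.sub_sub, Nat.cast_sub (by omega)]
    congr 1
    push_cast
    ring
  | succ r ih =>
    rw [← add_assoc, Finset.sum_range_succ, ih, fieldHarmonic_succ]
    have : (m : K) - ((m + r + 1 : ℕ) : K) = -((r : K) + 1) := by push_cast; ring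
    rw [this, inv_neg]
    ring

theorem sum_inv_add (K : Type*) [Field K] (m r : ℕ) :
    ∑ j ∈ Finset.range r, ((m : K) + j + 1)⁻¹ = fieldHarmonic K (m + r) - fieldHarmonic K m := by
  induction r with
  | zero => simp
  | succ r ih =>
    rw [Finset.sum_range_succ, ih, ← add_assoc, fieldHarmonic_succ]
    push_cast
    ring

/-- The difference is the sum of y⁻¹ over all of `ZMod p`, which vanishes under y ↦ -y. -/
theorem fieldHarmonic_sub (p : ℕ) [Fact p.Prime] (m r : ℕ) (h : m + r + 1 = p) (hp : 2 < p) :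
    fieldHarmonic (ZMod p) m = fieldHarmonic (ZMod p) r := by
  have h1 := sum_inv_sub (ZMod p) m r
  have h4 := (Equiv.subLeft (m : ZMod p)).sum_comp (fun y => y⁻¹)
  simp only [Equiv.subLeft_apply] at h4
  rw [h, ← sum_zmod_eq_sum_range p (fun j => ((m : ZMod p) - j)⁻¹), h4] at h1
  have h2 : ∑ y : ZMod p, y⁻¹ = -∑ y : ZMod p, y⁻¹ := by
    have h5 := Equiv.sum_comp (Equiv.neg (ZMod p)) (fun y => y⁻¹)
    simp only [Equiv.neg_apply, inv_neg, Finset.sum_neg_distrib] at h5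
    exact h5.symm
  have h3 : (2 : ZMod p) ≠ 0 := by
    exact_mod_cast mt (ZMod.natCast_eq_zero_iff 2 p).1 (Nat.not_dvd_of_pos_of_lt two_pos hp)
  apply mul_left_cancel₀ h3
  linear_combination -2 * h1 + h2

theorem alternating_sum_inv (K : Type*) [Field K] (h2 : (2 : K) ≠ 0) (s : ℕ) :
    ∑ i ∈ Finset.range (2 * s), (-1 : K) ^ i * ((i : K) + 1)⁻¹ =
      fieldHarmonic K (2 * s) - fieldHarmonic K s := by
  induction s with
  | zero => simp
  | succ s ih =>
    rw [show 2 * (s + 1) = 2 * s + 1 + 1 by ring, Finset.sum_range_succ, Finset.sum_range_succ, ih,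
      fieldHarmonic_succ, fieldHarmonic_succ, fieldHarmonic_succ]
    have h : (((2 * s + 1 : ℕ) : K) + 1)⁻¹ = 2⁻¹ * ((s : K) + 1)⁻¹ := by
      rw [← mul_inv]; congr 1; push_cast; ring
    have h' : (2 : K) * 2⁻¹ = 1 := mul_inv_cancel₀ h2
    rw [h]
    simp only [pow_succ, pow_mul]
    simp
    linear_combination -((s : K) + 1)⁻¹ * h'

/-! ### Trisection of binomial sums -/

theorem sum_choose_mul_succ {R : Type*} [CommRing R] (g : ℕ → R) (n : ℕ) :
    ∑ k ∈ Finset.range (n + 2), ((n + 1).choose k : R) * g k =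
      ∑ k ∈ Finset.range (n + 1), (n.choose k : R) * (g k + g (k + 1)) := by
  have h : ∑ k ∈ Finset.range (n + 1), (n.choose k : R) * g k =
      ∑ k ∈ Finset.range (n + 1), (n.choose (k + 1) : R) * g (k + 1) + g 0 := by
    have := Finset.sum_range_succ' (fun k => (n.choose k : R) * g k) (n + 1)
    rw [Finset.sum_range_succ] at this
    simpa using this
  rw [Finset.sum_range_succ']
  simp only [Nat.choose_succ_succ, Nat.cast_add, add_mul, mul_add, Finset.sum_add_distrib, h]
  simp
  ring

/-- Pascal's rule replaces h k by h k + h (k+1) = -h (k+2): each step shifts by 2 and changes sign.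
This is a cube-root-of-unity filter without roots of unity. -/
theorem sum_choose_mul_of_add_add_eq_zero {R : Type*} [CommRing R] (h : ℕ → R)
    (hh : ∀ k, h k + h (k + 1) + h (k + 2) = 0) (n : ℕ) :
    ∑ k ∈ Finset.range (n + 1), (n.choose k : R) * h k = (-1) ^ n * h (2 * n) := by
  induction n generalizing h with
  | zero => simp
  | succ n ih =>
    rw [sum_choose_mul_succ, ih _ fun k => by linear_combination hh k + hh (k + 1)]
    linear_combination (-1) ^ n * hh (2 * n)

theorem three_mul_sum_choose_three_dvd (p : ℕ) (hp : p % 6 = 1 ∨ p % 6 = 5) :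
    3 * ∑ k ∈ Finset.range (p + 1), (if 3 ∣ k then (p.choose k : ℤ) else 0) = 2 ^ p + 1 := by
  have h := sum_choose_mul_of_add_add_eq_zero (R := ℤ) (fun k => if 3 ∣ k then 2 else -1)
    (fun k => by split_ifs <;> omega) p
  have h2 : ∑ k ∈ Finset.range (p + 1), (p.choose k : ℤ) = 2 ^ p := by
    exact_mod_cast Nat.sum_range_choose p
  have hodd : Odd p := Nat.odd_iff.2 (by omega)
  simp only [hodd.neg_one_pow, if_neg (by omega : ¬ 3 ∣ 2 * p)] at h
  rw [← h2, Finset.mul_sum]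
  have : ∀ k, 3 * (if 3 ∣ k then (p.choose k : ℤ) else 0) =
      (p.choose k : ℤ) * (if 3 ∣ k then 2 else -1) + p.choose k := fun k => by
    split_ifs <;> ring
  simp only [this, Finset.sum_add_distrib, h]
  ring

theorem sum_range_three_mul {M : Type*} [AddCommMonoid M] (f : ℕ → M) (n : ℕ) :
    ∑ k ∈ Finset.range (3 * n), (if 3 ∣ k then f k else 0) = ∑ i ∈ Finset.range n, f (3 * i) := by
  induction n with
  | zero => simp
  | succ n ih =>
    rw [show 3 * (n + 1) = 3 * n + 1 + 1 + 1 by ring]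
    simp only [Finset.sum_range_succ, ih, dvd_mul_right, if_true]
    rw [if_neg (by omega), if_neg (by omega)]
    simp

/-! ### The derivative at m modulo p -/

theorem derivative_eval_eq_harmonic (p n m r : ℕ) [Fact p.Prime] (hp : 2 < p) (hpn : p = 2 * n + 1)
    (hmr : m + r = n) (P : (ZMod p)[X]) (hP : P.natDegree < p)
    (hsymm : ∀ x, P.eval (-1 - x) = P.eval x)
    (hval : ∀ j : ℕ, j ≤ n → P.eval (j : ZMod p) = -(2 * j + 1)) :
    P.derivative.eval (m : ZMod p) =
      -2 * (2 * m + 1) * (fieldHarmonic (ZMod p) m - fieldHarmonic (ZMod p) r) := by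
  have hpz : ((2 * n + 1 : ℕ) : ZMod p) = 0 := by rw [← hpn]; simp
  push_cast at hpz
  have hne : ∀ j : ℕ, 0 < j → j < p → (j : ZMod p) ≠ 0 := fun j h0 h1 =>
    mt (ZMod.natCast_eq_zero_iff j p).1 (Nat.not_dvd_of_pos_of_lt h0 h1)
  rw [derivative_eval_eq_sum_zmod p hp P hP, sum_zmod_eq_sum_range,
    show Finset.range p = Finset.range (n + 1 + n) by rw [hpn]; congr 1; ring,
    Finset.sum_range_add, ← Finset.sum_range_reflect _ n]
  -- At j = m the true term is 0 while the generic formula gives 2, hence the correction.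
  have h1 : ∀ j ∈ Finset.range (n + 1), P.eval (j : ZMod p) * ((m : ZMod p) - j)⁻¹ =
      2 - (2 * m + 1) * ((m : ZMod p) - j)⁻¹ - (if j = m then 2 else 0) := fun j hj => by
    rw [Finset.mem_range] at hj
    rw [hval j (by omega)]
    by_cases hjm : j = m
    · simp [hjm]
    · have : (m : ZMod p) - j ≠ 0 := by
        intro h
        rw [sub_eq_zero, ZMod.natCast_eq_natCast_iff', Nat.mod_eq_of_lt (by omega),
          Nat.mod_eq_of_lt (by omega)] at h
        exact hjm h.symm
      rw [if_neg hjm]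
      field_simp
      ring
  -- The upper residues are -1-j with j < n, where the symmetry supplies the value. The constants
  -- from both halves cancel: 2(n+1) - 2 - 2n = 0.
  have h2 : ∀ j ∈ Finset.range n,
      P.eval ((n + 1 + (n - 1 - j) : ℕ) : ZMod p) *
        ((m : ZMod p) - ((n + 1 + (n - 1 - j) : ℕ) : ZMod p))⁻¹ =
      (2 * m + 1) * ((m : ZMod p) + j + 1)⁻¹ - 2 := fun j hj => by
    rw [Finset.mem_range] at hj
    have h3 : ((n + 1 + (n - 1 - j) : ℕ) : ZMod p) = -1 - j := by
      rw [show n + 1 + (n - 1 - j) = 2 * n - j by omega, Nat.cast_sub (by omega)]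
      push_cast
      linear_combination hpz
    have h4 := hne (m + j + 1) (by omega) (by omega)
    push_cast at h4
    rw [h3, hsymm, hval j (by omega), show (m : ZMod p) - (-1 - j) = m + j + 1 by ring]
    field_simp
    ring
  rw [Finset.sum_congr rfl h1, Finset.sum_congr rfl h2]
  have h5 := sum_inv_sub (ZMod p) m r
  rw [hmr] at h5
  rw [Finset.sum_sub_distrib, Finset.sum_sub_distrib, Finset.sum_sub_distrib, ← Finset.mul_sum,
    ← Finset.mul_sum, h5, sum_inv_add, fieldHarmonic_sub p (m + n) r (by omega) hp,
    Finset.sum_ite_eq' (Finset.range (n + 1)) m (fun _ => (2 : ZMod p)),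
    if_pos (Finset.mem_range.2 (by omega))]
  simp
  ring

/-! ### The Fermat quotient of 2 -/

theorem choose_pred_prime (p : ℕ) [Fact p.Prime] (k : ℕ) (hk : k < p) :
    ((p - 1).choose k : ZMod p) = (-1) ^ k := by
  have hp : p.Prime := Fact.out
  induction k with
  | zero => simp
  | succ k ih =>
    have h := Nat.choose_succ_succ (p - 1) k
    rw [Nat.succ_eq_add_one, Nat.succ_eq_add_one, Nat.sub_add_cancel hp.one_le] at h
    have h2 := (ZMod.natCast_eq_zero_iff _ p).2 (hp.dvd_choose_self k.succ_ne_zero hk)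
    rw [Nat.succ_eq_add_one, h, Nat.cast_add, ih (by omega)] at h2
    linear_combination h2

/-- Twice the Fermat quotient of `2` as an alternating harmonic sum of length `⌊p / 3⌋`. -/
theorem fermat_quotient_two (p M : ℕ) [Fact p.Prime] (hp3 : 3 < p)
    (hM : p = 3 * M + 1 ∨ p = 3 * M + 2) (Q : ℤ) (hQ : (2 : ℤ) ^ p - 2 = p * Q) :
    (Q : ZMod p) = ∑ i ∈ Finset.range M, (-1 : ZMod p) ^ i * ((i : ZMod p) + 1)⁻¹ := by
  have hp : p.Prime := Fact.out
  have hodd : p % 2 = 1 := Nat.odd_iff.1 (hp.odd_of_ne_two (by omega))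
  have hne : ∀ j : ℕ, 0 < j → j < p → (j : ZMod p) ≠ 0 := fun j h0 h1 =>
    mt (ZMod.natCast_eq_zero_iff j p).1 (Nat.not_dvd_of_pos_of_lt h0 h1)
  have h1 := three_mul_sum_choose_three_dvd p (by omega)
  have h2 : ∑ k ∈ Finset.range (p + 1), (if 3 ∣ k then (p.choose k : ℤ) else 0) =
      ∑ i ∈ Finset.range (M + 1), (p.choose (3 * i) : ℤ) := by
    rw [← sum_range_three_mul (fun k => (p.choose k : ℤ))]
    rcases hM with h | h
    · rw [show 3 * (M + 1) = p + 1 + 1 by omega, Finset.sum_range_succ _ (p + 1), if_neg (by omega),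
        add_zero]
    · rw [show 3 * (M + 1) = p + 1 by omega]
  rw [h2, Finset.sum_range_succ'] at h1
  have h3 : ∀ i ∈ Finset.range M, ∃ b : ℤ, (p.choose (3 * (i + 1)) : ℤ) = p * b ∧
      3 * (b : ZMod p) = (-1 : ZMod p) ^ i * ((i : ZMod p) + 1)⁻¹ := fun i hi => by
    rw [Finset.mem_range] at hi
    obtain ⟨b, hb⟩ := hp.dvd_choose_self (k := 3 * (i + 1)) (by omega) (by omega)
    refine ⟨b, by exact_mod_cast hb, ?_⟩
    -- Absorption: C(p, 3(i+1)) = p/(3(i+1)) · C(p-1, 3i+2), and the last binomial is (-1)^i mod p.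
    have h4 := Nat.add_one_mul_choose_eq (p - 1) (3 * i + 2)
    rw [Nat.sub_add_cancel hp.one_le, show 3 * i + 2 + 1 = 3 * (i + 1) by ring, hb, mul_assoc] at h4
    have h5 := congrArg (Nat.cast (R := ZMod p)) (Nat.eq_of_mul_eq_mul_left hp.pos h4)
    have h6 := hne (i + 1) (by omega) (by omega)
    rw [choose_pred_prime p _ (by omega)] at h5
    push_cast at h5 h6 ⊢
    rw [eq_mul_inv_iff_mul_eq₀ h6, pow_add, pow_mul] at *
    norm_num at h5
    linear_combination -h5
  choose! b hb1 hb2 using h3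
  rw [Finset.sum_congr rfl hb1, ← Finset.mul_sum] at h1
  have h7 : Q = 3 * ∑ i ∈ Finset.range M, b i := by
    have : (p : ℤ) ≠ 0 := by exact_mod_cast hp.ne_zero
    apply mul_left_cancel₀ this
    simp at h1
    linear_combination -hQ - h1
  rw [h7, ← Finset.sum_congr rfl hb2, ← Finset.mul_sum]
  push_cast
  rfl

theorem exists_two_pow_sub_two (p : ℕ) [Fact p.Prime] : ∃ Q : ℤ, (2 : ℤ) ^ p - 2 = p * Q := by
  have : ((2 ^ p - 2 : ℤ) : ZMod p) = 0 := by push_cast; rw [ZMod.pow_card, sub_self]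
  exact (ZMod.intCast_zmod_eq_zero_iff_dvd _ p).1 this

/-! ### Taylor expansion in `ℤ_[p]` and transfer to `ℚ` -/

theorem padicInt_isUnit_intCast (p : ℕ) [Fact p.Prime] (d : ℤ) (hd : ¬ (p : ℤ) ∣ d) :
    IsUnit (d : ℤ_[p]) :=
  PadicInt.isUnit_iff.2 <| le_antisymm (PadicInt.norm_le_one _)
    (not_lt.1 fun h => hd ((PadicInt.norm_int_lt_one_iff_dvd d).1 h))

theorem padicInt_dvd_of_toZMod (p : ℕ) [Fact p.Prime] (x : ℤ_[p])
    (h : PadicInt.toZMod x = 0) : ∃ w : ℤ_[p], x = p * w := by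
  rw [← RingHom.mem_ker, PadicInt.ker_toZMod, PadicInt.maximalIdeal_eq_span_p,
    Ideal.mem_span_singleton] at h
  exact h

theorem prodSum_padic_congr (p n m r : ℕ) [Fact p.Prime] (hp : 2 < p) (hpn : p = 2 * n + 1)
    (hmr : m + r = n) (c : ℕ → ℤ_[p])
    (hc : ∀ k ≤ n, c k * ((k.factorial : ℤ_[p]) ^ 2 * (2 * k - 1)) = 1) (t : ℤ_[p]) :
    ∃ E z : ℤ_[p], (prodSum c n).eval (m + p * t) = -(2 * m + 1) + p * t * E + p ^ 2 * z ∧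
      PadicInt.toZMod E =
        -2 * (2 * m + 1) * (fieldHarmonic (ZMod p) m - fieldHarmonic (ZMod p) r) := by
  obtain ⟨z, hz⟩ := Polynomial.binomExpansion (prodSum c n) (m : ℤ_[p]) (p * t)
  refine ⟨(prodSum c n).derivative.eval (m : ℤ_[p]), z * t ^ 2, ?_, ?_⟩
  · rw [hz, prodSum_eval_natCast c n hc m (by omega)]
    ring
  · have h := derivative_eval_eq_harmonic p n m r hp hpn hmr
      ((prodSum c n).map PadicInt.toZMod) ?_ ?_ ?_
    · rw [← h, derivative_map, ← eval_natCast_map]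
    · exact (natDegree_map_le).trans_lt ((prodSum_natDegree_le c n).trans_lt (by omega))
    · intro x
      rw [prodSum_map, prodSum_eval_neg]
    · intro j hj
      rw [eval_natCast_map, prodSum_eval_natCast c n hc j hj, map_neg, map_add,
        map_mul, map_natCast, map_one, map_ofNat]

theorem isRatPIntegral_of_padicInt (p : ℕ) [Fact p.Prime] (x : ℚ) (X : ℤ_[p])
    (h : (X : ℚ_[p]) = x) : IsRatPIntegral p x := by
  intro hd
  have h1 : (X : ℚ_[p]) * ((x.den : ℤ_[p]) : ℚ_[p]) = ((x.num : ℤ_[p]) : ℚ_[p]) := by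
    rw [h]
    push_cast
    exact_mod_cast Rat.mul_den_eq_num x
  have h2 : X * (x.den : ℤ_[p]) = (x.num : ℤ_[p]) := Subtype.ext h1
  have h3 : (p : ℤ) ∣ x.num := by
    rw [← PadicInt.norm_int_lt_one_iff_dvd, ← h2, PadicInt.norm_lt_one_iff_dvd]
    exact Dvd.dvd.mul_left (Nat.cast_dvd_cast hd) _
  have h4 := Nat.dvd_gcd (Int.natCast_dvd.1 h3) hd
  rw [x.reduced] at h4
  exact (Fact.out : p.Prime).one_lt.ne' (Nat.dvd_one.1 h4)

/-- The unit d clears the denominator of y, so that the remaining check is a polynomial identity in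
`ℤ_[p]`. -/
theorem ratModEqPow_of_padicInt (p : ℕ) [Fact p.Prime] (x y : ℚ) (X z : ℤ_[p]) (d N : ℤ)
    (hX : (X : ℚ_[p]) = x) (hd : ¬ (p : ℤ) ∣ d) (hy : (d : ℚ) * y = N)
    (h : (d : ℤ_[p]) * X - N = p ^ 2 * z) : RatModEqPow p 2 x y := by
  obtain ⟨u, hu⟩ := (padicInt_isUnit_intCast p d hd).exists_left_inv
  have hY : ((u * N : ℤ_[p]) : ℚ_[p]) = y := by
    have h1 : (d : ℚ_[p]) * y = N := by exact_mod_cast congrArg (Rat.cast (K := ℚ_[p])) hy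
    have h2 : (u : ℚ_[p]) * d = 1 := by exact_mod_cast congrArg (fun q : ℤ_[p] => (q : ℚ_[p])) hu
    push_cast
    linear_combination y * h2 - u * h1
  have hp : (p : ℚ) ≠ 0 := by exact_mod_cast (Fact.out : p.Prime).ne_zero
  have hp' : (p : ℚ_[p]) ≠ 0 := by exact_mod_cast (Fact.out : p.Prime).ne_zero
  refine ⟨isRatPIntegral_of_padicInt p x X hX, isRatPIntegral_of_padicInt p y _ hY,
    (x - y) / p ^ 2, isRatPIntegral_of_padicInt p _ (u * z) ?_, by field_simp⟩
  have h3 : X - u * N = p ^ 2 * (u * z) := by linear_combination u * h - X * hu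
  have h4 := congrArg (fun q : ℤ_[p] => (q : ℚ_[p])) h3
  push_cast at h4 hY ⊢
  rw [eq_div_iff (pow_ne_zero 2 hp'), ← hX, ← hY, h4]
  ring

/-- For k ≤ n both k and |2k-1| are below p; the next index n+1 would give 2k-1 = p. -/
theorem exists_padicInt_inverses (p n : ℕ) [Fact p.Prime] (hpn : p = 2 * n + 1) :
    ∃ c : ℕ → ℤ_[p], ∀ k ≤ n, c k * ((k.factorial : ℤ_[p]) ^ 2 * (2 * k - 1)) = 1 := by
  have hp : p.Prime := Fact.out
  have hp2 := hp.two_le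
  have h : ∀ k : ℕ, ∃ c : ℤ_[p], k ≤ n → c * ((k.factorial : ℤ_[p]) ^ 2 * (2 * k - 1)) = 1 := by
    intro k
    by_cases hk : k ≤ n
    · have h1 : ¬ (p : ℤ) ∣ (k.factorial : ℤ) ^ 2 * (2 * k - 1) := by
        intro h
        rcases (Nat.prime_iff_prime_int.1 hp).dvd_or_dvd h with h | h
        · have := (Nat.prime_iff_prime_int.1 hp).dvd_of_dvd_pow h
          rw [Int.natCast_dvd_natCast, hp.dvd_factorial] at this
          omega
        · have := Int.eq_zero_of_abs_lt_dvd h (by rw [abs_lt]; constructor <;> omega)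
          omega
      obtain ⟨u, hu⟩ := (padicInt_isUnit_intCast p _ h1).exists_left_inv
      exact ⟨u, fun _ => by push_cast at hu; exact hu⟩
    · exact ⟨0, fun h => absurd h hk⟩
  choose c hc using h
  exact ⟨c, hc⟩

theorem prodSum_padic_eq_ratCast (p n : ℕ) [Fact p.Prime] (c : ℕ → ℤ_[p])
    (hc : ∀ k ≤ n, c k * ((k.factorial : ℤ_[p]) ^ 2 * (2 * k - 1)) = 1) (D v e : ℕ) (hD : D ≠ 0)
    (he : e ≠ 0) (N : ℕ → ℕ)
    (hN : ∀ k, N k * k.factorial ^ 2 = (∏ i ∈ Finset.range k, (D * (i * (i + 1)) + v)) * e ^ k)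
    (a : ℤ_[p]) (ha : (D : ℤ_[p]) * (a * (a + 1)) = -v) :
    (((prodSum c n).eval a : ℤ_[p]) : ℚ_[p]) =
      ((∑ k ∈ Finset.range (n + 1), (N k : ℚ) / ((2 * k - 1) * ((D * e : ℕ) : ℚ) ^ k) : ℚ)) := by
  rw [prodSum_eval, PadicInt.coe_sum]
  push_cast
  refine Finset.sum_congr rfl fun k hk => ?_
  rw [Finset.mem_range] at hk
  have h1 := hc k (by omega)
  have h2 : (∏ i ∈ Finset.range k, ((i : ℤ_[p]) * (i + 1) - a * (a + 1))) * (D : ℤ_[p]) ^ k =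
      ∏ i ∈ Finset.range k, ((D : ℤ_[p]) * (i * (i + 1)) + v) := by
    rw [← Finset.card_range k, ← Finset.prod_const, Finset.card_range, ← Finset.prod_mul_distrib]
    refine Finset.prod_congr rfl fun i _ => ?_
    linear_combination -ha
  have h3 : (N k : ℤ_[p]) * (k.factorial : ℤ_[p]) ^ 2 =
      (∏ i ∈ Finset.range k, ((D : ℤ_[p]) * (i * (i + 1)) + v)) * (e : ℤ_[p]) ^ k := by
    exact_mod_cast congrArg (Nat.cast (R := ℤ_[p])) (hN k)
  have h4 : c k * (∏ i ∈ Finset.range k, ((i : ℤ_[p]) * (i + 1) - a * (a + 1))) *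
      ((2 * k - 1) * (D * e) ^ k) = N k := by
    have hk0 : (k.factorial : ℤ_[p]) ^ 2 ≠ 0 :=
      pow_ne_zero _ (Nat.cast_ne_zero.2 k.factorial_ne_zero)
    apply mul_right_cancel₀ hk0
    rw [h3, ← h2, mul_pow]
    linear_combination (∏ i ∈ Finset.range k, ((i : ℤ_[p]) * (i + 1) - a * (a + 1))) *
      (D : ℤ_[p]) ^ k * (e : ℤ_[p]) ^ k * h1
  have h5 := congrArg (fun q : ℤ_[p] => (q : ℚ_[p])) h4
  have h6 : (2 * (k : ℚ_[p]) - 1) * (D * e) ^ k ≠ 0 := by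
    refine mul_ne_zero ?_ (pow_ne_zero _ (mul_ne_zero (by exact_mod_cast hD) (by exact_mod_cast he)))
    have : ((2 * (k : ℤ) - 1 : ℤ) : ℚ_[p]) ≠ 0 := Int.cast_ne_zero.2 (by omega)
    exact_mod_cast this
  rw [eq_div_iff h6]
  push_cast at h5
  exact h5

/-! ### Binomial products as Pochhammer products -/

theorem prod_four_mul_factorial (k : ℕ) :
    (∏ i ∈ Finset.range k, (16 * (i * (i + 1)) + 3)) * 4 ^ k * (2 * k).factorial =
      (4 * k).factorial := by
  induction k with
  | zero => simp
  | succ k ih =>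
    rw [show 4 * (k + 1) = 4 * k + 1 + 1 + 1 + 1 by ring, show 2 * (k + 1) = 2 * k + 1 + 1 by ring]
    simp only [Nat.factorial_succ, ← ih, Finset.prod_range_succ]
    ring

theorem prod_three_mul_factorial (k : ℕ) :
    (∏ i ∈ Finset.range k, (9 * (i * (i + 1)) + 2)) * 3 ^ k * k.factorial =
      (3 * k).factorial := by
  induction k with
  | zero => simp
  | succ k ih =>
    rw [show 3 * (k + 1) = 3 * k + 1 + 1 + 1 by ring]
    simp only [Nat.factorial_succ, ← ih, Finset.prod_range_succ]
    ring

theorem prod_six_mul_factorial (k : ℕ) :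
    (∏ i ∈ Finset.range k, (36 * (i * (i + 1)) + 5)) * 12 ^ k *
        ((3 * k).factorial * (2 * k).factorial) =
      (6 * k).factorial * k.factorial := by
  induction k with
  | zero => simp
  | succ k ih =>
    rw [show 6 * (k + 1) = 6 * k + 1 + 1 + 1 + 1 + 1 + 1 by ring,
      show 3 * (k + 1) = 3 * k + 1 + 1 + 1 by ring, show 2 * (k + 1) = 2 * k + 1 + 1 by ring]
    simp only [Nat.factorial_succ, Finset.prod_range_succ]
    linear_combination (36 * (k * (k + 1)) + 5) * 12 * ((3 * k + 1 + 1 + 1) * (3 * k + 1 + 1) *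
      (3 * k + 1) * ((2 * k + 1 + 1) * (2 * k + 1))) * ih

theorem choose_mul_choose_four (k : ℕ) :
    ((2 * k).choose k * (4 * k).choose (2 * k)) * k.factorial ^ 2 =
      (∏ i ∈ Finset.range k, (16 * (i * (i + 1)) + 3)) * 4 ^ k := by
  have h1 := Nat.choose_mul_factorial_mul_factorial (show k ≤ 2 * k by omega)
  have h2 := Nat.choose_mul_factorial_mul_factorial (show 2 * k ≤ 4 * k by omega)
  rw [show 2 * k - k = k by omega] at h1
  rw [show 4 * k - 2 * k = 2 * k by omega, ← prod_four_mul_factorial] at h2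
  have h3 := Nat.eq_of_mul_eq_mul_right (Nat.factorial_pos _) h2
  rw [← h3, ← h1]
  ring

theorem choose_mul_choose_three (k : ℕ) :
    ((2 * k).choose k * (3 * k).choose k) * k.factorial ^ 2 =
      (∏ i ∈ Finset.range k, (9 * (i * (i + 1)) + 2)) * 3 ^ k := by
  have h1 := Nat.choose_mul_factorial_mul_factorial (show k ≤ 2 * k by omega)
  have h2 := Nat.choose_mul_factorial_mul_factorial (show k ≤ 3 * k by omega)
  rw [show 2 * k - k = k by omega] at h1
  rw [show 3 * k - k = 2 * k by omega, ← prod_three_mul_factorial, ← h1] at h2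
  apply Nat.eq_of_mul_eq_mul_right k.factorial_pos
  rw [← h2]
  ring

theorem choose_mul_choose_six (k : ℕ) :
    ((3 * k).choose k * (6 * k).choose (3 * k)) * k.factorial ^ 2 =
      (∏ i ∈ Finset.range k, (36 * (i * (i + 1)) + 5)) * 12 ^ k := by
  have h1 := Nat.choose_mul_factorial_mul_factorial (show k ≤ 3 * k by omega)
  have h2 := Nat.choose_mul_factorial_mul_factorial (show 3 * k ≤ 6 * k by omega)
  rw [show 3 * k - k = 2 * k by omega] at h1
  rw [show 6 * k - 3 * k = 3 * k by omega] at h2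
  have h3 := prod_six_mul_factorial k
  apply Nat.eq_of_mul_eq_mul_right (Nat.mul_pos (3 * k).factorial_pos (2 * k).factorial_pos)
  rw [h3, ← h2]
  linear_combination ((6 * k).choose (3 * k)) * (3 * k).factorial * k.factorial * h1

theorem sum_Icc_choose_eq_padicInt (p n : ℕ) [Fact p.Prime] (c : ℕ → ℤ_[p])
    (hc : ∀ k ≤ n, c k * ((k.factorial : ℤ_[p]) ^ 2 * (2 * k - 1)) = 1) (D v e : ℕ) (hD : D ≠ 0)
    (he : e ≠ 0) (A B : ℕ → ℕ)
    (hN : ∀ k, (A k * B k) * k.factorial ^ 2 =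
      (∏ i ∈ Finset.range k, (D * (i * (i + 1)) + v)) * e ^ k)
    (a : ℤ_[p]) (ha : (D : ℤ_[p]) * (a * (a + 1)) = -v) (b : ℚ) (hb : ((D * e : ℕ) : ℚ) = b) :
    (((prodSum c n).eval a : ℤ_[p]) : ℚ_[p]) =
      ((∑ k ∈ Finset.Icc 0 n, ((A k : ℚ) * (B k : ℚ)) / ((2 * (k : ℚ) - 1) * b ^ k) : ℚ)) := by
  rw [prodSum_padic_eq_ratCast p n c hc D v e hD he (fun k => A k * B k) hN a ha, hb,
    Nat.range_succ_eq_Icc_zero]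
  simp only [Nat.cast_mul]

theorem exists_mul_eq_neg_one (p : ℕ) [Fact p.Prime] (d : ℤ) (hd : ¬ (p : ℤ) ∣ d) :
    ∃ t : ℤ_[p], d * t = -1 := by
  obtain ⟨u, hu⟩ := (padicInt_isUnit_intCast p d hd).exists_left_inv
  exact ⟨-u, by linear_combination -hu⟩

theorem prime_not_dvd_two_pow_mul_three_pow (p : ℕ) (hp : p.Prime) (hp3 : 3 < p) (a b : ℕ) :
    ¬ (p : ℤ) ∣ 2 ^ a * 3 ^ b := by
  intro h
  have h' : p ∣ 2 ^ a * 3 ^ b := by exact_mod_cast h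
  rcases hp.dvd_mul.1 h' with h | h
  · exact absurd (Nat.le_of_dvd two_pos (hp.dvd_of_dvd_pow h)) (by omega)
  · exact absurd (Nat.le_of_dvd three_pos (hp.dvd_of_dvd_pow h)) (by omega)

/-- The upper index is ⌊p/3⌋ and s = ⌊p/6⌋. In the second case the alternating sum has odd length,
and its last term extends H_{2s} to H_{2s+1}. -/
theorem harmonic_third_sub_sixth (p s : ℕ) [Fact p.Prime] (hp3 : 3 < p) (Q : ℤ)
    (hQ : (2 : ℤ) ^ p - 2 = p * Q) :
    (p = 6 * s + 1 → fieldHarmonic (ZMod p) (2 * s) - fieldHarmonic (ZMod p) s = Q) ∧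
    (p = 6 * s + 5 → fieldHarmonic (ZMod p) (2 * s + 1) - fieldHarmonic (ZMod p) s = Q) := by
  have h2 : (2 : ZMod p) ≠ 0 := by
    exact_mod_cast mt (ZMod.natCast_eq_zero_iff 2 p).1 (Nat.not_dvd_of_pos_of_lt two_pos (by omega))
  constructor
  · intro h
    rw [fermat_quotient_two p (2 * s) hp3 (by omega) Q hQ, alternating_sum_inv _ h2]
  · intro h
    rw [fermat_quotient_two p (2 * s + 1) hp3 (by omega) Q hQ, Finset.sum_range_succ,
      alternating_sum_inv _ h2, fieldHarmonic_succ, pow_mul]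
    norm_num
    ring

theorem zmod_cast_self (p q : ℕ) (h : p = q) : (q : ZMod p) = 0 := by
  rw [← h, ZMod.natCast_self]

theorem legendreSym_three (p : ℕ) :
    (p % 3 = 1 → legendreSym 3 (p : ℤ) = 1) ∧ (p % 3 = 2 → legendreSym 3 (p : ℤ) = -1) := by
  constructor <;> intro h <;>
    rw [legendreSym.mod, show ((p : ℤ) % (3 : ℕ)) = ((p % 3 : ℕ) : ℤ) by simp, h] <;> decide

/-! ### The three congruences -/

theorem sum_choose_four_congr (p n : ℕ) [Fact p.Prime] (hp3 : 3 < p) (hpn : p = 2 * n + 1) :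
    RatModEqPow p 2
      (∑ k ∈ Finset.Icc 0 n,
        ((Nat.choose (2 * k) k : ℚ) * (Nat.choose (4 * k) (2 * k) : ℚ)) /
          ((2 * (k : ℚ) - 1) * 64 ^ k))
      ((-1 : ℚ) ^ (n + 1) * (((p : ℚ) + 1) / 2)) := by
  have hp : p.Prime := Fact.out
  obtain ⟨c, hc⟩ := exists_padicInt_inverses p n hpn
  obtain ⟨t, ht⟩ := exists_mul_eq_neg_one p 4 (prime_not_dvd_two_pow_mul_three_pow p hp hp3 2 0)
  have h2 := prime_not_dvd_two_pow_mul_three_pow p hp hp3 1 0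
  push_cast at ht
  obtain ⟨m, h | h⟩ : ∃ m, p = 4 * m + 1 ∨ p = 4 * m + 3 := ⟨p / 4, by omega⟩
  · obtain ⟨E, z, hEz, hE⟩ := prodSum_padic_congr p n m m (by omega) hpn (by omega) c hc t
    rw [sub_self, mul_zero] at hE
    obtain ⟨w, hw⟩ := padicInt_dvd_of_toZMod p _ hE
    have hpz : (p : ℤ_[p]) = 4 * m + 1 := by exact_mod_cast congrArg (Nat.cast (R := ℤ_[p])) h
    refine ratModEqPow_of_padicInt p _ _ _ (2 * t * w + 2 * z) 2 (-(p + 1))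
      (sum_Icc_choose_eq_padicInt p n c hc 16 3 4 (by norm_num) (by norm_num) _ _
        choose_mul_choose_four (m + p * t) ?_ 64 (by norm_num)) h2 ?_ ?_
    · have : 4 * (m + p * t) = -1 := by linear_combination p * ht - hpz
      push_cast
      linear_combination (4 * (m + p * t) + 3) * this
    · have : Odd (n + 1) := Nat.odd_iff.2 (by omega)
      rw [this.neg_one_pow]
      push_cast
      ring
    · rw [hEz, hw]
      push_cast
      linear_combination hpz
  -- Here m + pt = -3/4, the mirror image of -1/4.
  · obtain ⟨E, z, hEz, hE⟩ := prodSum_padic_congr p n m (m + 1) (by omega) hpn (by omega) c hc t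
    have hpz : (p : ℤ_[p]) = 4 * m + 3 := by exact_mod_cast congrArg (Nat.cast (R := ℤ_[p])) h
    -- m ≡ -3/4 gives E ≡ 2(2m+1)/(m+1) ≡ -4.
    have hE' : PadicInt.toZMod (E + 4) = 0 := by
      have h3 := zmod_cast_self p _ h
      push_cast at h3
      have h4 : ((m : ZMod p) + 1)⁻¹ = 4 := inv_eq_of_mul_eq_one_left (by linear_combination h3)
      rw [fieldHarmonic_succ, h4] at hE
      rw [map_add, hE, map_ofNat]
      linear_combination 4 * h3
    obtain ⟨w, hw⟩ := padicInt_dvd_of_toZMod p _ hE'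
    refine ratModEqPow_of_padicInt p _ _ _ (2 * t * w + 2 * z) 2 (p + 1)
      (sum_Icc_choose_eq_padicInt p n c hc 16 3 4 (by norm_num) (by norm_num) _ _
        choose_mul_choose_four (m + p * t) ?_ 64 (by norm_num)) h2 ?_ ?_
    · have : 4 * (m + p * t) = -3 := by linear_combination p * ht - hpz
      push_cast
      linear_combination (4 * (m + p * t) + 1) * this
    · have : Even (n + 1) := Nat.even_iff.2 (by omega)
      rw [this.neg_one_pow]
      push_cast
      ring
    · rw [hEz]
      push_cast
      linear_combination hpz + 2 * p * t * hw - 2 * p * ht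

theorem sum_choose_three_congr (p n : ℕ) [Fact p.Prime] (hp3 : 3 < p) (hpn : p = 2 * n + 1) :
    RatModEqPow p 2
      (∑ k ∈ Finset.Icc 0 n,
        ((Nat.choose (2 * k) k : ℚ) * (Nat.choose (3 * k) k : ℚ)) /
          ((2 * (k : ℚ) - 1) * 27 ^ k))
      ((1 / 9 : ℚ) * (legendreSym 3 (p : ℤ) : ℚ) * (2 ^ (p + 1) - 7 - 6 * (p : ℚ))) := by
  have hp : p.Prime := Fact.out
  obtain ⟨c, hc⟩ := exists_padicInt_inverses p n hpn
  obtain ⟨t, ht⟩ := exists_mul_eq_neg_one p 3 (prime_not_dvd_two_pow_mul_three_pow p hp hp3 0 1)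
  obtain ⟨Q, hQ⟩ := exists_two_pow_sub_two p
  have h9 := prime_not_dvd_two_pow_mul_three_pow p hp hp3 0 2
  have hQz : (2 : ℤ_[p]) ^ p - 2 = p * Q := by exact_mod_cast congrArg (Int.cast (R := ℤ_[p])) hQ
  push_cast at ht
  have hp_not_dvd : ¬ 3 ∣ p := fun h => by
    have := (Nat.prime_dvd_prime_iff_eq Nat.prime_three hp).1 h
    omega
  obtain ⟨s, h | h⟩ : ∃ s, p = 6 * s + 1 ∨ p = 6 * s + 5 := ⟨p / 6, by omega⟩
  · obtain ⟨E, z, hEz, hE⟩ := prodSum_padic_congr p n (2 * s) s (by omega) hpn (by omega) c hc t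
    have hpz : (p : ℤ_[p]) = 6 * s + 1 := by exact_mod_cast congrArg (Nat.cast (R := ℤ_[p])) h
    -- 2m+1 ≡ 1/3, and the harmonic difference is Q.
    have hE' : PadicInt.toZMod (3 * E + 2 * (Q : ℤ_[p])) = 0 := by
      have h3 := zmod_cast_self p _ h
      rw [(harmonic_third_sub_sixth p s hp3 Q hQ).1 h] at hE
      push_cast at h3 hE
      rw [map_add, map_mul, hE, map_mul, map_ofNat, map_ofNat, map_intCast]
      linear_combination -4 * Q * h3
    obtain ⟨w, hw⟩ := padicInt_dvd_of_toZMod p _ hE'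
    refine ratModEqPow_of_padicInt p _ _ _ (-w + 9 * z) 9 (2 ^ (p + 1) - 7 - 6 * p)
      (sum_Icc_choose_eq_padicInt p n c hc 9 2 3 (by norm_num) (by norm_num) _ _
        choose_mul_choose_three (((2 * s : ℕ) : ℤ_[p]) + p * t) ?_ 27 (by norm_num)) h9 ?_ ?_
    · have : 3 * (((2 * s : ℕ) : ℤ_[p]) + p * t) = -1 := by
        push_cast
        linear_combination p * ht - hpz
      push_cast at this ⊢
      linear_combination (3 * (2 * s + p * t) + 2) * this
    · rw [(legendreSym_three p).1 (by omega)]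
      push_cast
      ring
    · rw [hEz, pow_succ]
      push_cast
      linear_combination 3 * p * E * ht - p * hw - 2 * hQz + 6 * hpz
  · obtain ⟨E, z, hEz, hE⟩ :=
      prodSum_padic_congr p n (2 * s + 1) (s + 1) (by omega) hpn (by omega) c hc t
    have hpz : (p : ℤ_[p]) = 6 * s + 5 := by exact_mod_cast congrArg (Nat.cast (R := ℤ_[p])) h
    -- 2m+1 ≡ -1/3, and the difference is Q - 1/(s+1) ≡ Q - 6.
    have hE' : PadicInt.toZMod (3 * E - 2 * (Q : ℤ_[p]) + 12) = 0 := by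
      have h3 := zmod_cast_self p _ h
      push_cast at h3
      have h4 : ((s : ZMod p) + 1)⁻¹ = 6 := inv_eq_of_mul_eq_one_left (by linear_combination h3)
      have h5 := (harmonic_third_sub_sixth p s hp3 Q hQ).2 h
      rw [fieldHarmonic_succ _ s, h4] at hE
      push_cast at hE
      rw [map_add, map_sub, map_mul, hE, map_mul, map_ofNat, map_ofNat, map_ofNat, map_intCast]
      linear_combination -6 * (4 * s + 3) * h5 - 4 * (Q - 6) * h3
    obtain ⟨w, hw⟩ := padicInt_dvd_of_toZMod p _ hE'
    refine ratModEqPow_of_padicInt p _ _ _ (-w + 9 * z) 9 (-(2 ^ (p + 1) - 7 - 6 * p))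
      (sum_Icc_choose_eq_padicInt p n c hc 9 2 3 (by norm_num) (by norm_num) _ _
        choose_mul_choose_three (((2 * s + 1 : ℕ) : ℤ_[p]) + p * t) ?_ 27 (by norm_num)) h9 ?_ ?_
    · have : 3 * (((2 * s + 1 : ℕ) : ℤ_[p]) + p * t) = -2 := by
        push_cast
        linear_combination p * ht - hpz
      push_cast at this ⊢
      linear_combination (3 * (2 * s + 1 + p * t) + 1) * this
    · rw [(legendreSym_three p).2 (by omega)]
      push_cast
      ring
    · rw [hEz, pow_succ]
      push_cast
      linear_combination 3 * p * E * ht - p * hw + 2 * hQz + 6 * hpz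

theorem sum_choose_six_congr (p n : ℕ) [Fact p.Prime] (hp3 : 3 < p) (hpn : p = 2 * n + 1) :
    RatModEqPow p 2
      (∑ k ∈ Finset.Icc 0 n,
        ((Nat.choose (3 * k) k : ℚ) * (Nat.choose (6 * k) (3 * k) : ℚ)) /
          ((2 * (k : ℚ) - 1) * 432 ^ k))
      (-(1 / 9 : ℚ) * (legendreSym 3 (p : ℤ) : ℚ) * (2 ^ (p + 1) + 2 + 3 * (p : ℚ))) := by
  have hp : p.Prime := Fact.out
  obtain ⟨c, hc⟩ := exists_padicInt_inverses p n hpn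
  obtain ⟨t, ht⟩ := exists_mul_eq_neg_one p 6 (prime_not_dvd_two_pow_mul_three_pow p hp hp3 1 1)
  obtain ⟨Q, hQ⟩ := exists_two_pow_sub_two p
  have h18 := prime_not_dvd_two_pow_mul_three_pow p hp hp3 1 2
  have hQz : (2 : ℤ_[p]) ^ p - 2 = p * Q := by exact_mod_cast congrArg (Int.cast (R := ℤ_[p])) hQ
  push_cast at ht
  have hp_not_dvd : ¬ 3 ∣ p := fun h => by
    have := (Nat.prime_dvd_prime_iff_eq Nat.prime_three hp).1 h
    omega
  obtain ⟨s, h | h⟩ : ∃ s, p = 6 * s + 1 ∨ p = 6 * s + 5 := ⟨p / 6, by omega⟩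
  · obtain ⟨E, z, hEz, hE⟩ := prodSum_padic_congr p n s (2 * s) (by omega) hpn (by omega) c hc t
    have hpz : (p : ℤ_[p]) = 6 * s + 1 := by exact_mod_cast congrArg (Nat.cast (R := ℤ_[p])) h
    have hE' : PadicInt.toZMod (3 * E - 4 * (Q : ℤ_[p])) = 0 := by
      have h3 := zmod_cast_self p _ h
      have h5 := (harmonic_third_sub_sixth p s hp3 Q hQ).1 h
      push_cast at h3
      rw [map_sub, map_mul, hE, map_mul, map_ofNat, map_ofNat, map_intCast]
      linear_combination 6 * (2 * s + 1) * h5 + 2 * Q * h3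
    obtain ⟨w, hw⟩ := padicInt_dvd_of_toZMod p _ hE'
    -- Scaling by 18 rather than 9 makes 18t = -3 an integer.
    refine ratModEqPow_of_padicInt p _ _ _ (-w + 18 * z) (2 * 9) (-2 * (2 ^ (p + 1) + 2 + 3 * p))
      (sum_Icc_choose_eq_padicInt p n c hc 36 5 12 (by norm_num) (by norm_num) _ _
        choose_mul_choose_six (s + p * t) ?_ 432 (by norm_num)) h18 ?_ ?_
    · have : 6 * ((s : ℤ_[p]) + p * t) = -1 := by linear_combination p * ht - hpz
      push_cast
      linear_combination (6 * (s + p * t) + 5) * this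
    · rw [(legendreSym_three p).1 (by omega)]
      push_cast
      ring
    · rw [hEz, pow_succ]
      push_cast
      linear_combination 3 * p * E * ht - p * hw + 4 * hQz + 6 * hpz
  · obtain ⟨E, z, hEz, hE⟩ :=
      prodSum_padic_congr p n s (2 * s + 1 + 1) (by omega) hpn (by omega) c hc t
    have hpz : (p : ℤ_[p]) = 6 * s + 5 := by exact_mod_cast congrArg (Nat.cast (R := ℤ_[p])) h
    -- 2m+1 ≡ -2/3, and the difference is -Q - 1/(2s+2) ≡ -Q - 3.
    have hE' : PadicInt.toZMod (3 * E + 4 * (Q : ℤ_[p]) + 12) = 0 := by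
      have h3 := zmod_cast_self p _ h
      have h5 := (harmonic_third_sub_sixth p s hp3 Q hQ).2 h
      push_cast at h3
      have h4 : (((2 * s + 1 : ℕ) : ZMod p) + 1)⁻¹ = 3 :=
        inv_eq_of_mul_eq_one_left (by push_cast; linear_combination h3)
      rw [fieldHarmonic_succ _ (2 * s + 1), h4] at hE
      rw [map_add, map_add, map_mul, hE, map_mul, map_ofNat, map_ofNat, map_ofNat, map_intCast]
      linear_combination 6 * (2 * s + 1) * h5 + 2 * (Q + 3) * h3
    obtain ⟨w, hw⟩ := padicInt_dvd_of_toZMod p _ hE'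
    refine ratModEqPow_of_padicInt p _ _ _ (-w + 18 * z) (2 * 9) (2 * (2 ^ (p + 1) + 2 + 3 * p))
      (sum_Icc_choose_eq_padicInt p n c hc 36 5 12 (by norm_num) (by norm_num) _ _
        choose_mul_choose_six (s + p * t) ?_ 432 (by norm_num)) h18 ?_ ?_
    · have : 6 * ((s : ℤ_[p]) + p * t) = -5 := by linear_combination p * ht - hpz
      push_cast
      linear_combination (6 * (s + p * t) + 1) * this
    · rw [(legendreSym_three p).2 (by omega)]
      push_cast
      ring
    · rw [hEz, pow_succ]
      push_cast
      linear_combination 3 * p * E * ht - p * hw - 4 * hQz + 6 * hpz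

end

theorem theorem4p3 (p : ℕ) (hp : p.Prime) (hp3 : 3 < p) :
    RatModEqPow p 2
      (∑ k ∈ Finset.Icc 0 ((p - 1) / 2),
        ((Nat.choose (2 * k) k : ℚ) * (Nat.choose (4 * k) (2 * k) : ℚ)) /
          ((2 * (k : ℚ) - 1) * 64 ^ k))
      ((-1 : ℚ) ^ ((p + 1) / 2) * (((p : ℚ) + 1) / 2)) ∧
    RatModEqPow p 2
      (∑ k ∈ Finset.Icc 0 ((p - 1) / 2),
        ((Nat.choose (2 * k) k : ℚ) * (Nat.choose (3 * k) k : ℚ)) /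
          ((2 * (k : ℚ) - 1) * 27 ^ k))
      ((1 / 9 : ℚ) * (legendreSym 3 (p : ℤ) : ℚ) * (2 ^ (p + 1) - 7 - 6 * (p : ℚ))) ∧
    RatModEqPow p 2
      (∑ k ∈ Finset.Icc 0 ((p - 1) / 2),
        ((Nat.choose (3 * k) k : ℚ) * (Nat.choose (6 * k) (3 * k) : ℚ)) /
          ((2 * (k : ℚ) - 1) * 432 ^ k))
      (-(1 / 9 : ℚ) * (legendreSym 3 (p : ℤ) : ℚ) * (2 ^ (p + 1) + 2 + 3 * (p : ℚ))) := by
  have : Fact p.Prime := ⟨hp⟩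
  have hodd : p % 2 = 1 := Nat.odd_iff.1 (hp.odd_of_ne_two (by omega))
  have hpn : p = 2 * ((p - 1) / 2) + 1 := by omega
  rw [show (p + 1) / 2 = (p - 1) / 2 + 1 by omega]
  exact ⟨sum_choose_four_congr p _ hp3 hpn, sum_choose_three_congr p _ hp3 hpn,
    sum_choose_six_congr p _ hp3 hpn⟩
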